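/- Let $X$ be an at most countable set and let $\lambda\colon X\times X\to[0,\infty)$ be a weight function: for every $x$ the set $\{y:\lambda(x,y)\neq0\}$ is finite and $\sum_{y}\lambda(x,y)=1$. View $X$ as a directed graph with an edge from $x$ to $y$ when $\lambda(x,y)>0$, and suppose that it is locally finite, i.e. the sets $\{x:\lambda(x,y)\neq0\}$ are finite as well. Let $\partial X=\{x:\lambda(x,x)=1\}$ and $X^\circ=X\setminus\partial X$. Suppose that $X$ is connected (every vertex can be reached by a directed path from every $x\in X^\circ$) and quasi-reversible ($\lambda(x,y)>0$ implies $\lambda(y,x)>0$ or $\lambda(y,y)=1$). A ray is a sequence $x_0x_1x_2\ldots$ of distinct vertices with $\lambda(x_i,x_{i+1})>0$ for all $i$. For finite $A\subset X$ the components of $X\setminus A$ are those of the underlying undirected graph; a ray ends in the component that contains infinitely many of its vertices. Two rays are equivalent if for every finite $A$ they end in the same component of $X\setminus A$; an end is an equivalence class of rays. Let $\partial_{end}X$ be the set of ends, $\hat X=X\cup\partial_{end}X$ and $\partial\hat X=\partial X\cup\partial_{end}X$. A sequence $(p_n)$ in $\hat X$ converges to an end $\omega$ if for every finite $A\subset X$,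 for all large $n$, $p_n$ and $\omega$ lie in the same component of $X\setminus A$ (an end lies in the component in which its rays end). A function $f\colon\partial\hat X\to\mathbb R$ is continuous at infinity if $f(p_n)\to f(\omega)$ whenever $(p_n)\subset\partial\hat X$ converges to an end $\omega$. Let $S(\hat X)$ be the set of $f\colon\hat X\to\mathbb R$ with $\sum_y\lambda(x,y)[f(y)-f(x)]\ge0$ for all $x\in X$ and $\limsup_{i\to\infty}f(x_i)\le f(\omega)$ for every end $\omega$ and every ray $x_0x_1\ldots$ in $\omega$, and let $H(\hat X)=S(\hat X)\cap(-S(\hat X))$. Let $G(x,y)=\sum_{k\ge0}\lambda^{\diamond k}(x,y)\in[0,\infty]$ be the Green's function, where $\lambda^{\diamond k}(x,y)$ is the $k$-step transition weight: $\lambda^{\diamond 0}(x,y)$ is $1$ if $x=y$ and $0$ otherwise, and $\lambda^{\diamond(k+1)}(x,y)=\sum_{z\in X}\lambda(x,z)\lambda^{\diamond k}(z,y)$. Suppose that $X$ has finitely many ends, that $G$ is transient, i.e. $G(x,y)<\infty$ for all $x,y\in X^\circ$, and that $G$ vanishes at infinity, i.e. $G(x_n,y)\to0$ for every $y\in X^\circ$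 and every sequence $(x_n)\subset X$ that converges to an end. Then for every bounded $f\colon\partial\hat X\to\mathbb R$ that is continuous at infinity there is a unique $h\in H(\hat X)$ with $h=f$ on $\partial\hat X$. -/

import Mathlib

open Filter Topology

namespace DirichletEnds

noncomputable section

/-- A weight function on `X`: nonnegative, with finitely many nonzero entries in each row, and with
all row sums equal to `1`. `0 < w x y` means that there is a directed edge from `x` to `y`. -/
structure IsWeight {X : Type*} (w : X → X → ℝ) : Prop where
  nonneg : ∀ x y, 0 ≤ w x y
  finite_out : ∀ x, {y | w x y ≠ 0}.Finite
  sum_eq_one : ∀ x, ∑ᶠ y, w x y = 1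

/-- The weighted directed graph is locally finite: every vertex has finitely many out-neighbours
and finitely many in-neighbours. -/
def IsLocallyFinite {X : Type*} (w : X → X → ℝ) : Prop :=
  ∀ x, {y | w x y ≠ 0}.Finite ∧ {y | w y x ≠ 0}.Finite

/-- The Kiselman boundary `∂X`. -/
def bdry {X : Type*} (w : X → X → ℝ) : Set X := {x | w x x = 1}

/-- The interior `X° = X \ ∂X`. -/
def inter {X : Type*} (w : X → X → ℝ) : Set X := (bdry w)ᶜ

/-- The sets `N_k(a)`: the vertices reached from `a` by a directed path of `k` edges. -/
def nbhd {X : Type*} (w : X → X → ℝ) (a : X) : ℕ → Set X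
  | 0 => {a}
  | k + 1 => {y | ∃ x ∈ nbhd w a k, 0 < w x y}

/-- `X` is connected: every vertex is reached by a directed path from every interior vertex. -/
def IsConn {X : Type*} (w : X → X → ℝ) : Prop :=
  ∀ a ∈ inter w, ⋃ k, nbhd w a k = Set.univ

/-- `X` is quasi-reversible: edges can be reversed, except those that lead to boundary points. -/
def IsQuasiReversible {X : Type*} (w : X → X → ℝ) : Prop :=
  ∀ x y, 0 < w x y → 0 < w y x ∨ w y y = 1

/-- The Laplacian of `f` at `x`. -/
def laplacian {X : Type*} (w : X → X → ℝ) (f : X → ℝ) (x : X) : ℝ :=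
  ∑ᶠ z, w x z * (f z - f x)

/-- Subharmonic functions on `X`. -/
def IsSubharmonic {X : Type*} (w : X → X → ℝ) (f : X → ℝ) : Prop :=
  ∀ x, 0 ≤ laplacian w f x

/-- The product `f ⋄ g`. -/
def diamond {X : Type*} (f g : X → X → ℝ) (x y : X) : ℝ := ∑ᶠ z, f x z * g z y

open Classical in
/-- The powers of `w` for the product `⋄` (the `k`-step transition probabilities). -/
def diamondPow {X : Type*} (w : X → X → ℝ) : ℕ → X → X → ℝ
  | 0 => fun x y => if x = y then 1 else 0
  | k + 1 => diamond w (diamondPow w k)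

/-- The Green's function, with values in `[0, ∞]`. -/
def green {X : Type*} (w : X → X → ℝ) (x y : X) : ENNReal :=
  ∑' k : ℕ, ENNReal.ofReal (diamondPow w k x y)

/-- Transience of the Green's function. The target `y` is an interior point: for `y ∈ ∂X` that can
be reached from `x`, the series always diverges, as `y` is absorbing. -/
def IsTransient {X : Type*} (w : X → X → ℝ) : Prop :=
  ∀ x ∈ inter w, ∀ y ∈ inter w, green w x y < ⊤

/-- The underlying undirected graph. -/
def undir {X : Type*} (w : X → X → ℝ) : SimpleGraph X :=
  SimpleGraph.fromRel fun x y => 0 < w x y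

/-- The connected components of `X \ A`, for a finite set `A` of vertices. -/
abbrev Comp {X : Type*} (w : X → X → ℝ) (A : Finset X) : Type _ :=
  (undir w).ComponentCompl (A : Set X)

/-- A (directed) ray: an infinite directed path without repeated vertices. -/
structure Ray {X : Type*} (w : X → X → ℝ) where
  vert : ℕ → X
  inj : Function.Injective vert
  edge : ∀ i, 0 < w (vert i) (vert (i + 1))

/-- The ray `π` ends in the component `C`: infinitely many of its vertices lie in `C`. -/
def Ray.EndsIn {X : Type*} {w : X → X → ℝ} {A : Finset X} (π : Ray w) (C : Comp w A) : Prop :=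
  {i | π.vert i ∈ C}.Infinite

theorem Ray.exists_tail {X : Type*} {w : X → X → ℝ} (π : Ray w) (A : Finset X) :
    ∃ (C : Comp w A) (N : ℕ), ∀ i ≥ N, π.vert i ∈ C := by
  have hfin : {i | π.vert i ∈ A}.Finite :=
    A.finite_toSet.preimage π.inj.injOn
  obtain ⟨N, hN⟩ := hfin.bddAbove
  have hout : ∀ i, N + 1 ≤ i → π.vert i ∉ (A : Set X) := by
    intro i hi hA
    have : i ≤ N := hN hA
    omega
  refine ⟨(undir w).componentComplMk (hout (N + 1) le_rfl), N + 1, fun i hi => ?_⟩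
  induction i, hi using Nat.le_induction with
  | base => exact SimpleGraph.componentComplMk_mem _ _
  | succ i hi ih =>
    refine SimpleGraph.ComponentCompl.mem_of_adj (π.vert i) (π.vert (i + 1)) ih
      (hout (i + 1) (by omega)) ?_
    rw [undir, SimpleGraph.fromRel_adj]
    refine ⟨fun h => ?_, Or.inl (π.edge i)⟩
    have := π.inj h
    omega

theorem Ray.exists_endsIn {X : Type*} {w : X → X → ℝ} (π : Ray w) (A : Finset X) :
    ∃ C : Comp w A, π.EndsIn C := by
  obtain ⟨C, N, h⟩ := π.exists_tail A
  exact ⟨C, (Set.Ici_infinite N).mono h⟩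

theorem Ray.EndsIn.unique {X : Type*} {w : X → X → ℝ} {A : Finset X} {π : Ray w} {C D : Comp w A}
    (hC : π.EndsIn C) (hD : π.EndsIn D) : C = D := by
  obtain ⟨E, N, h⟩ := π.exists_tail A
  have key : ∀ F : Comp w A, π.EndsIn F → F = E := by
    intro F hF
    obtain ⟨i, hi, hNi⟩ := hF.exists_gt N
    have h1 := h i hNi.le
    obtain ⟨ha, ha'⟩ := hi
    obtain ⟨hb, hb'⟩ := h1
    exact ha'.symm.trans hb'
  rw [key C hC, key D hD]

/-- Two rays are equivalent if, for every finite `A`, they end in the same component of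
`X \ A`. -/
def raySetoid {X : Type*} (w : X → X → ℝ) : Setoid (Ray w) where
  r π π' := ∀ A : Finset X, ∃ C : Comp w A, π.EndsIn C ∧ π'.EndsIn C
  iseqv :=
    { refl := fun π A => by
        obtain ⟨C, hC⟩ := π.exists_endsIn A
        exact ⟨C, hC, hC⟩
      symm := fun h A => by
        obtain ⟨C, h1, h2⟩ := h A
        exact ⟨C, h2, h1⟩
      trans := fun h h' A => by
        obtain ⟨C, h1, h2⟩ := h A
        obtain ⟨D, h3, h4⟩ := h' A
        exact ⟨C, h1, h2.unique h3 ▸ h4⟩ }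

/-- The ends of `X`. -/
def End {X : Type*} (w : X → X → ℝ) : Type _ := Quotient (raySetoid w)

/-- The end to which a ray belongs. -/
def Ray.toEnd {X : Type*} {w : X → X → ℝ} (π : Ray w) : End w := Quotient.mk (raySetoid w) π

/-- `X̂`, the vertices together with the ends. -/
abbrev Hat {X : Type*} (w : X → X → ℝ) : Type _ := X ⊕ End w

/-- The boundary `∂X̂`, consisting of `∂X` and of all the ends. -/
def bdryHat {X : Type*} (w : X → X → ℝ) : Set (Hat w) :=
  Sum.inl '' bdry w ∪ Set.range Sum.inr

/-- An end, as a point of `∂X̂`. -/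
def endPt {X : Type*} {w : X → X → ℝ} (ω : End w) : bdryHat w := ⟨Sum.inr ω, Or.inr ⟨ω, rfl⟩⟩

/-- The point `p` of `X̂` lies in the component of `X̂ \ A` given by the component `C` of `X \ A`;
an end lies there if its rays end in `C`. -/
def LiesIn {X : Type*} {w : X → X → ℝ} {A : Finset X} (p : Hat w) (C : Comp w A) : Prop :=
  match p with
  | Sum.inl x => x ∈ C
  | Sum.inr ω => ∃ π : Ray w, π.toEnd = ω ∧ π.EndsIn C

/-- Convergence of sequences in `X̂`. -/
def ConvergesTo {X : Type*} {w : X → X → ℝ} (p : ℕ → Hat w) (q : Hat w) : Prop :=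
  ∀ A : Finset X, ∃ N : ℕ, ∀ n > N, ∃ C : Comp w A, LiesIn (p n) C ∧ LiesIn q C

/-- The Green's function vanishes at infinity. -/
def GreenVanishes {X : Type*} (w : X → X → ℝ) : Prop :=
  ∀ (x : ℕ → X) (ω : End w), ConvergesTo (w := w) (fun n => Sum.inl (x n)) (Sum.inr ω) →
    ∀ y ∈ inter w, Tendsto (fun n => green w (x n) y) atTop (𝓝 0)

/-- Boundary data that are continuous at infinity, that is, at every end. -/
def ContinuousAtInfinity {X : Type*} {w : X → X → ℝ} (f : bdryHat w → ℝ) : Prop :=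
  ∀ (ω : End w) (p : ℕ → bdryHat w), ConvergesTo (fun n => (p n : Hat w)) (Sum.inr ω) →
    Tendsto (fun n => f (p n)) atTop (𝓝 (f (endPt ω)))

/-- The class `S(X̂)` of subharmonic functions on `X̂`; the upper limits are taken in the extended
real numbers. -/
def subharmonicHat {X : Type*} (w : X → X → ℝ) : Set (Hat w → ℝ) :=
  {f | IsSubharmonic w (fun x => f (Sum.inl x)) ∧
    ∀ (ω : End w) (π : Ray w), π.toEnd = ω →
      limsup (fun i => ((f (Sum.inl (π.vert i)) : ℝ) : EReal)) atTop
        ≤ ((f (Sum.inr ω) : ℝ) : EReal)}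

/-- The class `H(X̂)` of harmonic functions on `X̂`: those `h` with both `h` and `-h` in `S(X̂)`. -/
def harmonicHat {X : Type*} (w : X → X → ℝ) : Set (Hat w → ℝ) :=
  {h | h ∈ subharmonicHat w ∧ -h ∈ subharmonicHat w}

end

end DirichletEnds

/-! Uniqueness comes from a maximum principle, `le_of_isSubharmonic`. Suppose a subharmonic `u`
exceeds its bound `c` at `x`, and follow the edges that lead to values at least `u x`. If they reach
infinitely many vertices, Kőnig's lemma extracts a ray on which `u` stays above `c`. Otherwise a
maximum over the reached set propagates, by connectedness, to all of `X`. Then `X` is finite without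
boundary, and the infinite total Green mass contradicts transience.

For existence, extend `f` to a function `F` that is constant near each end. All but finitely many
vertices are near an end (`finite_compl_iUnion_near`), so by local finiteness `ΔF` has finite
support. Then `F + GΔF` is harmonic, equals `F` on `∂X` because boundary points are absorbing, and
has the limits of `F` along rays because `G` vanishes at infinity. Boundary points may accumulate at
an end, so constancy near ends costs an error on `∂X`, which continuity at infinity makes
arbitrarily small. By the maximum principle these approximate solutions are uniformly Cauchy, and
their limit is the solution. -/

open Relation

/-! ### Breadth-first search and Kőnig's lemma -/

/-- The vertices reached from `o` along `k` steps of the relation `E`. -/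
def relLevel {α : Type*} (E : α → α → Prop) (o : α) : ℕ → Set α
  | 0 => {o}
  | k + 1 => {y | ∃ x ∈ relLevel E o k, E x y}

theorem exists_mem_relLevel {α : Type*} {E : α → α → Prop} {o y : α} (h : ReflTransGen E o y) :
    ∃ n, y ∈ relLevel E o n := by
  induction h with
  | refl => exact ⟨0, rfl⟩
  | tail _ hbc ih =>
    obtain ⟨n, hn⟩ := ih
    exact ⟨n + 1, _, hn, hbc⟩

/-- The directed distance from `o` along the relation `E`. -/
noncomputable def relDist {α : Type*} (E : α → α → Prop) (o y : α) : ℕ :=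
  sInf {n | y ∈ relLevel E o n}

/-- `b` is a child of `a` in the breadth-first search from `o`. -/
def GeodesicStep {α : Type*} (E : α → α → Prop) (o a b : α) : Prop :=
  E a b ∧ relDist E o b = relDist E o a + 1

theorem relDist_self {α : Type*} (E : α → α → Prop) (o : α) : relDist E o o = 0 :=
  Nat.sInf_eq_zero.2 (Or.inl rfl)

/-- On a path of minimal length, each vertex is one level further from `o` than its predecessor.
Restricting to geodesic steps therefore loses no reachable vertex. -/
theorem reflTransGen_geodesicStep {α : Type*} {E : α → α → Prop} {o y : α}
    (h : ReflTransGen E o y) : ReflTransGen (GeodesicStep E o) o y := by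
  have main : ∀ n y, y ∈ relLevel E o n → relDist E o y = n →
      ReflTransGen (GeodesicStep E o) o y := by
    intro n
    induction n with
    | zero =>
      intro y hy _
      rw [show y = o from hy]
    | succ n ih =>
      rintro y ⟨x, hx, hxy⟩ hd
      have h1 : relDist E o x ≤ n := Nat.sInf_le hx
      have h2 : x ∈ relLevel E o (relDist E o x) :=
        Nat.sInf_mem (s := {n | x ∈ relLevel E o n}) ⟨n, hx⟩
      have h3 : relDist E o y ≤ relDist E o x + 1 := Nat.sInf_le ⟨x, h2, hxy⟩
      have h4 : relDist E o x = n := by omega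
      exact (ih x hx h4).tail ⟨hxy, by omega⟩
  exact main _ y (Nat.sInf_mem (s := {n | y ∈ relLevel E o n}) (exists_mem_relLevel h)) rfl

/-- **Kőnig's lemma**: a geodesic path that stays an ancestor of infinitely many members of `Y`. -/
theorem exists_geodesic_path {α : Type*} {E : α → α → Prop} (hfin : ∀ a, {b | E a b}.Finite)
    {o : α} {Y : Set α} (hY : Y.Infinite) (hreach : ∀ y ∈ Y, ReflTransGen E o y) :
    ∃ s : ℕ → α, s 0 = o ∧ (∀ i, GeodesicStep E o (s i) (s (i + 1))) ∧
      ∀ i, {y ∈ Y | ReflTransGen (GeodesicStep E o) (s i) y}.Infinite := by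
  have hstep : ∀ a : {a : α // {y ∈ Y | ReflTransGen (GeodesicStep E o) a y}.Infinite},
      ∃ b : {a : α // {y ∈ Y | ReflTransGen (GeodesicStep E o) a y}.Infinite},
        GeodesicStep E o a b := by
    rintro ⟨a, ha⟩
    by_contra! hcon
    -- If every child had only finitely many descendants in `Y`, so would `a`: they are among `a`
    -- itself and the descendants of its finitely many children.
    refine ha (((Set.finite_singleton a).union
      (((hfin a).subset (t := {b | GeodesicStep E o a b}) fun b hb => hb.1).biUnion
        (t := fun b => {y ∈ Y | ReflTransGen (GeodesicStep E o) b y}) ?_)).subset ?_)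
    · intro b hb
      by_contra hinf
      exact hcon ⟨b, hinf⟩ hb
    · rintro y ⟨hyY, hy⟩
      rcases ReflTransGen.cases_head hy with rfl | ⟨b, hab, hby⟩
      · exact Or.inl rfl
      · exact Or.inr (Set.mem_biUnion (show b ∈ {b | GeodesicStep E o a b} from hab) ⟨hyY, hby⟩)
  choose next hnext using hstep
  have h0 : {y ∈ Y | ReflTransGen (GeodesicStep E o) o y}.Infinite :=
    hY.mono fun y hy => ⟨hy, reflTransGen_geodesicStep (hreach y hy)⟩
  refine ⟨fun i => (next^[i] ⟨o, h0⟩).1, rfl, fun i => ?_, fun i => (next^[i] ⟨o, h0⟩).2⟩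
  simp only [Function.iterate_succ_apply']
  exact hnext _

theorem relDist_of_geodesic_path {α : Type*} {E : α → α → Prop} {o : α} {s : ℕ → α} (h0 : s 0 = o)
    (hs : ∀ i, GeodesicStep E o (s i) (s (i + 1))) (i : ℕ) : relDist E o (s i) = i := by
  induction i with
  | zero => rw [h0, relDist_self]
  | succ i ih => rw [(hs i).2, ih]

theorem injective_of_geodesic_path {α : Type*} {E : α → α → Prop} {o : α} {s : ℕ → α}
    (h0 : s 0 = o) (hs : ∀ i, GeodesicStep E o (s i) (s (i + 1))) : Function.Injective s := by
  intro i j hij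
  rw [← relDist_of_geodesic_path h0 hs i, hij, relDist_of_geodesic_path h0 hs j]

/-! ### Weights, the Laplacian and the Green's function -/

namespace DirichletEnds

variable {X : Type*} {w : X → X → ℝ}

theorem reflTransGen_of_mem_nbhd {a : X} {k : ℕ} {y : X} (h : y ∈ nbhd w a k) :
    ReflTransGen (fun a b => 0 < w a b) a y := by
  induction k generalizing y with
  | zero => rw [show y = a from h]
  | succ k ih =>
    obtain ⟨x, hx, hxy⟩ := h
    exact (ih hx).tail hxy

theorem IsConn.reflTransGen (hconn : IsConn w) {a : X} (ha : a ∈ inter w) (y : X) :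
    ReflTransGen (fun a b => 0 < w a b) a y := by
  have : y ∈ ⋃ k, nbhd w a k := by rw [hconn a ha]; trivial
  obtain ⟨k, hk⟩ := Set.mem_iUnion.1 this
  exact reflTransGen_of_mem_nbhd hk

namespace IsWeight

/-- The set of out-neighbours of `x`. -/
noncomputable def out (hw : IsWeight w) (x : X) : Finset X := (hw.finite_out x).toFinset

theorem mem_out (hw : IsWeight w) {x z : X} : z ∈ hw.out x ↔ w x z ≠ 0 := by
  simp [out]

theorem finsum_mul (hw : IsWeight w) (x : X) (f : X → ℝ) :
    ∑ᶠ z, w x z * f z = ∑ z ∈ hw.out x, w x z * f z := by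
  apply finsum_eq_sum_of_support_subset
  intro z hz
  exact Finset.mem_coe.2 (hw.mem_out.2 (left_ne_zero_of_mul hz))

theorem sum_out (hw : IsWeight w) (x : X) : ∑ z ∈ hw.out x, w x z = 1 := by
  have := hw.finsum_mul x fun _ => 1
  simp only [mul_one] at this
  rw [← this, hw.sum_eq_one]

theorem laplacian_eq (hw : IsWeight w) (f : X → ℝ) (x : X) :
    laplacian w f x = ∑ z ∈ hw.out x, w x z * (f z - f x) :=
  hw.finsum_mul x fun z => f z - f x

theorem laplacian_eq_sub (hw : IsWeight w) (f : X → ℝ) (x : X) :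
    laplacian w f x = (∑ z ∈ hw.out x, w x z * f z) - f x := by
  rw [hw.laplacian_eq]
  simp only [mul_sub, Finset.sum_sub_distrib, ← Finset.sum_mul, hw.sum_out, one_mul]

theorem eq_zero_of_mem_bdry (hw : IsWeight w) {x z : X} (hx : x ∈ bdry w) (hz : z ≠ x) :
    w x z = 0 := by
  classical
  by_contra hne
  have hx' : w x x = 1 := hx
  have hsub : ({z, x} : Finset X) ⊆ hw.out x := by
    intro y hy
    simp only [Finset.mem_insert, Finset.mem_singleton] at hy
    rcases hy with rfl | rfl
    · exact hw.mem_out.2 hne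
    · exact hw.mem_out.2 (by rw [hx']; exact one_ne_zero)
  have := Finset.sum_le_sum_of_subset_of_nonneg hsub fun i _ _ => hw.nonneg x i
  rw [hw.sum_out, Finset.sum_pair hz, hx'] at this
  exact hne (le_antisymm (by linarith) (hw.nonneg x z))

theorem laplacian_eq_zero_of_mem_bdry (hw : IsWeight w) (f : X → ℝ) {x : X} (hx : x ∈ bdry w) :
    laplacian w f x = 0 := by
  rw [hw.laplacian_eq]
  refine Finset.sum_eq_zero fun z _ => ?_
  by_cases hz : z = x
  · simp [hz]
  · simp [hw.eq_zero_of_mem_bdry hx hz]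

theorem laplacian_add (hw : IsWeight w) (f g : X → ℝ) (x : X) :
    laplacian w (fun z => f z + g z) x = laplacian w f x + laplacian w g x := by
  simp only [hw.laplacian_eq, ← Finset.sum_add_distrib]
  exact Finset.sum_congr rfl fun z _ => by ring

theorem laplacian_sub (hw : IsWeight w) (f g : X → ℝ) (x : X) :
    laplacian w (fun z => f z - g z) x = laplacian w f x - laplacian w g x := by
  simp only [hw.laplacian_eq, ← Finset.sum_sub_distrib]
  exact Finset.sum_congr rfl fun z _ => by ring

theorem laplacian_neg (hw : IsWeight w) (f : X → ℝ) (x : X) :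
    laplacian w (fun z => -f z) x = -laplacian w f x := by
  simp only [hw.laplacian_eq, ← Finset.sum_neg_distrib]
  exact Finset.sum_congr rfl fun z _ => by ring

theorem laplacian_sum_mul (hw : IsWeight w) {ι : Type*} (s : Finset ι) (g : X → ι → ℝ) (c : ι → ℝ)
    (x : X) : laplacian w (fun z => ∑ y ∈ s, g z y * c y) x =
      ∑ y ∈ s, laplacian w (fun z => g z y) x * c y := by
  simp only [hw.laplacian_eq, Finset.sum_mul, ← Finset.sum_sub_distrib, Finset.mul_sum]
  rw [Finset.sum_comm]
  exact Finset.sum_congr rfl fun _ _ => Finset.sum_congr rfl fun _ _ => by ring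

theorem diamondPow_succ (hw : IsWeight w) (k : ℕ) (x y : X) :
    diamondPow w (k + 1) x y = ∑ z ∈ hw.out x, w x z * diamondPow w k z y :=
  hw.finsum_mul x fun z => diamondPow w k z y

theorem diamondPow_nonneg (hw : IsWeight w) (k : ℕ) (x y : X) : 0 ≤ diamondPow w k x y := by
  induction k generalizing x with
  | zero => simp only [diamondPow]; split_ifs <;> norm_num
  | succ k ih =>
    rw [hw.diamondPow_succ]
    exact Finset.sum_nonneg fun z _ => mul_nonneg (hw.nonneg _ _) (ih z)

theorem sum_diamondPow [Fintype X] (hw : IsWeight w) (k : ℕ) (x : X) :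
    ∑ y, diamondPow w k x y = 1 := by
  induction k generalizing x with
  | zero => classical simp [diamondPow]
  | succ k ih =>
    simp only [hw.diamondPow_succ]
    rw [Finset.sum_comm]
    simp only [← Finset.mul_sum, ih, mul_one, hw.sum_out]

/-- Every `k`-step transition row has mass one, so exchanging the sums leaves a divergent series of
ones. -/
theorem sum_green [Fintype X] (hw : IsWeight w) (x : X) : ∑ y, green w x y = ⊤ := by
  simp only [green]
  rw [← Summable.tsum_finsetSum fun _ _ => ENNReal.summable]
  simp only [← ENNReal.ofReal_sum_of_nonneg fun _ _ => hw.diamondPow_nonneg _ _ _,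
    hw.sum_diamondPow, ENNReal.ofReal_one]
  exact ENNReal.tsum_const_eq_top_of_ne_zero one_ne_zero

theorem diamondPow_eq_zero (hw : IsWeight w) {x y : X} (hx : x ∈ bdry w) (hy : y ∈ inter w)
    (k : ℕ) : diamondPow w k x y = 0 := by
  induction k with
  | zero =>
    have : x ≠ y := fun h => hy (h ▸ hx)
    simp [diamondPow, this]
  | succ k ih =>
    rw [hw.diamondPow_succ]
    refine Finset.sum_eq_zero fun z _ => ?_
    by_cases hz : z = x
    · rw [hz, ih, mul_zero]
    · rw [hw.eq_zero_of_mem_bdry hx hz, zero_mul]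

/-- Boundary points are absorbing. Hence adding Green potentials of interior points does not alter
boundary values. -/
theorem green_eq_zero (hw : IsWeight w) {x y : X} (hx : x ∈ bdry w) (hy : y ∈ inter w) :
    green w x y = 0 := by
  simp [green, hw.diamondPow_eq_zero hx hy]

theorem green_ne_top (hw : IsWeight w) (htrans : IsTransient w) (x : X) {y : X}
    (hy : y ∈ inter w) : green w x y ≠ ⊤ := by
  by_cases hx : x ∈ bdry w
  · simp [hw.green_eq_zero hx hy]
  · exact (htrans x hx y hy).ne

-- First-step decomposition: split off `k = 0` and factor the first step out of the remaining terms.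
-- In `ENNReal` this needs no convergence.
open Classical in
theorem green_eq (hw : IsWeight w) (x y : X) :
    green w x y = (if x = y then 1 else 0) +
      ∑ z ∈ hw.out x, ENNReal.ofReal (w x z) * green w z y := by
  rw [green, tsum_eq_zero_add' ENNReal.summable]
  congr 1
  · simp only [diamondPow]; split_ifs <;> simp
  · simp only [green, ← ENNReal.tsum_mul_left]
    rw [← Summable.tsum_finsetSum fun _ _ => ENNReal.summable]
    refine tsum_congr fun k => ?_
    rw [hw.diamondPow_succ, ENNReal.ofReal_sum_of_nonneg fun z _ =>
      mul_nonneg (hw.nonneg _ _) (hw.diamondPow_nonneg _ _ _)]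
    exact Finset.sum_congr rfl fun z _ => ENNReal.ofReal_mul (hw.nonneg _ _)

open Classical in
theorem laplacian_green (hw : IsWeight w) (htrans : IsTransient w) (x : X) {y : X}
    (hy : y ∈ inter w) :
    laplacian w (fun z => (green w z y).toReal) x = if x = y then -1 else 0 := by
  have hfin : ∀ z ∈ hw.out x, ENNReal.ofReal (w x z) * green w z y ≠ ⊤ := fun z _ =>
    ENNReal.mul_ne_top ENNReal.ofReal_ne_top (hw.green_ne_top htrans z hy)
  have h := congrArg ENNReal.toReal (hw.green_eq x y)
  rw [ENNReal.toReal_add (by split_ifs <;> simp) (ENNReal.sum_ne_top.2 hfin),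
    ENNReal.toReal_sum hfin] at h
  simp only [ENNReal.toReal_mul, ENNReal.toReal_ofReal (hw.nonneg _ _)] at h
  rw [hw.laplacian_eq_sub, h]
  split_ifs <;> simp

end IsWeight

/-! ### Subharmonic functions bounded on the boundary and along rays -/

/-- The maximum principle. -/
theorem le_of_isSubharmonic (hw : IsWeight w) (hconn : IsConn w) (htrans : IsTransient w)
    {u : X → ℝ} (hu : IsSubharmonic w u) {c : ℝ} (hbdry : ∀ x ∈ bdry w, u x ≤ c)
    (hray : ∀ (π : Ray w) (c' : ℝ), c < c' → ∃ i, u (π.vert i) < c') (x : X) : u x ≤ c := by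
  by_contra! hx
  let E : X → X → Prop := fun a b => 0 < w a b ∧ u x ≤ u b
  have hEfin : ∀ a, {b | E a b}.Finite := fun a =>
    (hw.finite_out a).subset fun b hb => hb.1.ne'
  let K : Set X := {y | ReflTransGen E x y}
  have hKu : ∀ y ∈ K, u x ≤ u y := by
    intro y hy
    rcases ReflTransGen.cases_tail hy with h | ⟨z, _, hz⟩
    · rw [h]
    · exact hz.2
  have hKinter : ∀ y ∈ K, y ∈ inter w := fun y hy hb => by
    linarith [hbdry y hb, hKu y hy]
  by_cases hK : K.Finite
  · obtain ⟨y, hyK, hmax⟩ := hK.exists_maximalFor u K ⟨x, ReflTransGen.refl⟩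
    have hmax' : ∀ z ∈ K, u z ≤ u y := fun z hz => by
      by_contra! hlt
      exact absurd (hmax hz hlt.le) (not_le.2 hlt)
    have hclosed : ∀ z, ReflTransGen (fun a b => 0 < w a b) y z → z ∈ K ∧ u z = u y := by
      intro z hz
      induction hz with
      | refl => exact ⟨hyK, rfl⟩
      | @tail a b _ hab ih =>
        obtain ⟨haK, hau⟩ := ih
        have hmem : ∀ v, 0 < w a v → u x ≤ u v → v ∈ K := fun v hv hv' =>
          ReflTransGen.tail haK ⟨hv, hv'⟩
        have hle : ∀ v ∈ hw.out a, w a v * (u v - u a) ≤ 0 := by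
          intro v hv
          have hpos : 0 < w a v := (hw.nonneg a v).lt_of_ne' (hw.mem_out.1 hv)
          refine mul_nonpos_of_nonneg_of_nonpos hpos.le ?_
          -- A neighbour with `u v < u x` may lie outside `K`, but its value is still below `u a`;
          -- so `u a` is maximal among all neighbours.
          rcases le_or_gt (u x) (u v) with h | h
          · linarith [hmax' v (hmem v hpos h)]
          · linarith [hKu a haK]
        have hsum := hu a
        rw [hw.laplacian_eq] at hsum
        have hz := (Finset.sum_eq_zero_iff_of_nonpos hle).1
          (le_antisymm (Finset.sum_nonpos hle) hsum) b (hw.mem_out.2 hab.ne')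
        have hub : u b = u a := by
          rcases mul_eq_zero.1 hz with h | h
          · exact absurd h hab.ne'
          · linarith
        exact ⟨hmem b hab (hub ▸ hKu a haK), hub.trans hau⟩
    have hall : ∀ z, z ∈ K := fun z => (hclosed z (hconn.reflTransGen (hKinter y hyK) z)).1
    have : Finite X := Set.finite_univ_iff.1 (hK.subset fun z _ => hall z)
    have := Fintype.ofFinite X
    have h1 := hw.sum_green y
    rw [ENNReal.sum_eq_top] at h1
    obtain ⟨z, _, hz⟩ := h1
    exact (htrans y (hKinter y hyK) z (hKinter z (hall z))).ne hz
  · obtain ⟨s, h0, hs, _⟩ := exists_geodesic_path hEfin hK fun y hy => hy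
    obtain ⟨i, hi⟩ := hray ⟨s, injective_of_geodesic_path h0 hs, fun i => (hs i).1.1⟩ (u x) hx
    have : u x ≤ u (s i) := by
      cases i with
      | zero => rw [h0]
      | succ i => exact (hs i).1.2
    exact absurd hi (not_lt.2 this)

/-! ### Neighbourhoods of ends -/

theorem LiesIn.unique {A : Finset X} {ω : End w} {C D : Comp w A}
    (hC : LiesIn (Sum.inr ω) C) (hD : LiesIn (Sum.inr ω) D) : C = D := by
  obtain ⟨π, hπ, h1⟩ := hC
  obtain ⟨π', hπ', h2⟩ := hD
  obtain ⟨B, h3, h4⟩ := Quotient.exact (hπ.trans hπ'.symm) A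
  rw [h1.unique h3, h2.unique h4]

/-- The vertices in the component of `X \ A` in which the rays of `ω` end. -/
def near (A : Finset X) (ω : End w) : Set X :=
  {x | ∃ C : Comp w A, x ∈ C ∧ LiesIn (Sum.inr ω) C}

theorem near_anti {A B : Finset X} (h : A ⊆ B) (ω : End w) : near B ω ⊆ near A ω := by
  rintro x ⟨C, hx, π, hπ, hC⟩
  have h' : (A : Set X) ⊆ B := Finset.coe_subset.2 h
  exact ⟨C.hom h', C.subset_hom h' hx, π, hπ, hC.mono fun i hi => C.subset_hom h' hi⟩

theorem mem_near_of_edge {A : Finset X} {ω : End w} {x z : X} (hx : x ∈ near A ω) (hz : z ∉ A)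
    (hxz : 0 < w x z) : z ∈ near A ω := by
  obtain ⟨C, hC, hω⟩ := hx
  by_cases hne : x = z
  · exact hne ▸ ⟨C, hC, hω⟩
  · refine ⟨C, SimpleGraph.ComponentCompl.mem_of_adj x z hC hz ?_, hω⟩
    rw [undir, SimpleGraph.fromRel_adj]
    exact ⟨hne, Or.inl hxz⟩

theorem Ray.eventually_mem_near (π : Ray w) (A : Finset X) :
    ∀ᶠ i in atTop, π.vert i ∈ near A π.toEnd := by
  obtain ⟨C, N, h⟩ := π.exists_tail A
  exact eventually_atTop.2 ⟨N, fun i hi => ⟨C, h i hi, π, rfl, (Set.Ici_infinite N).mono h⟩⟩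

theorem convergesTo_of_eventually_mem_near {x : ℕ → X} {ω : End w}
    (h : ∀ A, ∀ᶠ i in atTop, x i ∈ near A ω) :
    ConvergesTo (w := w) (fun i => Sum.inl (x i)) (Sum.inr ω) := by
  intro A
  obtain ⟨N, hN⟩ := eventually_atTop.1 (h A)
  exact ⟨N, fun n hn => hN n hn.le⟩

/-- All but finitely many vertices are near some end. -/
theorem finite_compl_iUnion_near (hw : IsWeight w) (hconn : IsConn w) {o : X} (ho : o ∈ inter w)
    (A : Finset X) : (⋃ ω : End w, near A ω)ᶜ.Finite := by
  by_contra hinf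
  let E : X → X → Prop := fun a b => 0 < w a b
  obtain ⟨s, h0, hs, hdesc⟩ := exists_geodesic_path (E := E)
    (fun a => (hw.finite_out a).subset fun b (hb : 0 < w a b) => hb.ne') hinf
    fun y _ => hconn.reflTransGen ho y
  let π : Ray w := ⟨s, injective_of_geodesic_path h0 hs, fun i => (hs i).1⟩
  -- Geodesic steps only increase the distance from `o`, so beyond level `n` they never meet `A` and
  -- stay in one component.
  let n := A.sup (relDist E o)
  obtain ⟨i, hi, hni⟩ := ((π.eventually_mem_near A).and (eventually_gt_atTop n)).exists
  obtain ⟨y, hy, hiy⟩ := (hdesc i).nonempty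
  refine hy (Set.mem_iUnion.2 ⟨π.toEnd, ?_⟩)
  have hfar : ∀ z, n < relDist E o z → z ∉ A := fun z hz hzA =>
    absurd (Finset.le_sup (f := relDist E o) hzA) (not_le.2 hz)
  suffices h : y ∈ near A π.toEnd ∧ n < relDist E o y from h.1
  clear hy
  induction hiy with
  | refl => exact ⟨hi, by rw [relDist_of_geodesic_path h0 hs]; exact hni⟩
  | @tail b c _ hbc ih =>
    obtain ⟨h1, h2⟩ := ih
    have h3 : n < relDist E o c := by rw [hbc.2]; omega
    exact ⟨mem_near_of_edge h1 (hfar c h3) hbc.1, h3⟩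

/-- Finitely many ends lie in distinct components of the complement of a finite set. -/
theorem exists_separating [Finite (End w)] :
    ∃ A : Finset X, ∀ (ω ω' : End w) (x : X), x ∈ near A ω → x ∈ near A ω' → ω = ω' := by
  classical
  have hpair : ∀ p : End w × End w, ∃ A : Finset X,
      ∀ x, x ∈ near A p.1 → x ∈ near A p.2 → p.1 = p.2 := by
    rintro ⟨ω, ω'⟩
    by_contra! hcon
    -- The inequality of the ends is the same for every finite set, so the empty set serves to
    -- extract it.
    obtain ⟨_, _, _, hne⟩ := hcon ∅
    refine hne ?_
    induction ω using Quotient.inductionOn with | _ π =>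
    induction ω' using Quotient.inductionOn with | _ π' =>
    refine Quotient.sound fun A => ?_
    obtain ⟨x, ⟨C, hxC, hC⟩, ⟨D, hxD, hD⟩, -⟩ := hcon A
    have hCD : C = D := by
      obtain ⟨ha, rfl⟩ := hxC
      obtain ⟨hb, rfl⟩ := hxD
      rfl
    subst hCD
    obtain ⟨C1, h1⟩ := π.exists_endsIn A
    obtain ⟨C2, h2⟩ := π'.exists_endsIn A
    refine ⟨C, ?_, ?_⟩
    · rwa [hC.unique (D := C1) ⟨π, rfl, h1⟩]
    · rwa [hD.unique (D := C2) ⟨π', rfl, h2⟩]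
  choose A hA using hpair
  have := Fintype.ofFinite (End w)
  refine ⟨Finset.univ.biUnion A, fun ω ω' x hx hx' => ?_⟩
  have hsub : A (ω, ω') ⊆ Finset.univ.biUnion A :=
    Finset.subset_biUnion_of_mem A (Finset.mem_univ (ω, ω'))
  exact hA (ω, ω') x (near_anti hsub ω hx) (near_anti hsub ω' hx')

/-- Countability exhausts `X` by finite sets, so a failure for every `A` produces a sequence of
boundary points converging to `ω`, as needed to apply sequential continuity. -/
theorem exists_dist_lt_on_near [Countable X] {f : bdryHat w → ℝ} (hcont : ContinuousAtInfinity f)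
    (ω : End w) {ε : ℝ} (hε : 0 < ε) : ∃ A : Finset X, ∀ x, ∀ hx : x ∈ bdry w, x ∈ near A ω →
      |f ⟨Sum.inl x, Or.inl ⟨x, hx, rfl⟩⟩ - f (endPt ω)| < ε := by
  classical
  by_contra! hcon
  obtain ⟨e, he⟩ := Countable.exists_injective_nat X
  let B : ℕ → Finset X := fun n => ((Finset.range n).finite_toSet.preimage he.injOn).toFinset
  choose b hb hnear hfar using fun n => hcon (B n)
  have hmem : ∀ A : Finset X, ∀ᶠ n in atTop, b n ∈ near A ω := by
    intro A
    filter_upwards [eventually_gt_atTop (A.sup e)] with n hn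
    refine near_anti (fun x hx => ?_) ω (hnear n)
    simp only [B, Set.Finite.mem_toFinset, Set.mem_preimage, Finset.mem_coe, Finset.mem_range]
    exact (Finset.le_sup hx).trans_lt hn
  have := hcont ω (fun n => ⟨Sum.inl (b n), Or.inl ⟨b n, hb n, rfl⟩⟩)
    (convergesTo_of_eventually_mem_near hmem)
  obtain ⟨n, hn⟩ := (Metric.tendsto_nhds.1 this ε hε).exists
  rw [Real.dist_eq] at hn
  exact absurd hn (not_lt.2 (hfar n))

/-! ### Construction of solutions -/

/-- Boundary data with an extension whose Laplacian has finite support. -/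
theorem exists_harmonic_sub_tendsto_zero (hw : IsWeight w) (htrans : IsTransient w)
    (hvanish : GreenVanishes w) {F : X → ℝ} (hF : {x | laplacian w F x ≠ 0}.Finite) :
    ∃ h : X → ℝ, (∀ x, laplacian w h x = 0) ∧ (∀ x ∈ bdry w, h x = F x) ∧
      ∀ π : Ray w, Tendsto (fun i => h (π.vert i) - F (π.vert i)) atTop (𝓝 0) := by
  classical
  have hS : ∀ y ∈ hF.toFinset, y ∈ inter w := by
    intro y hy hb
    exact (hF.mem_toFinset.1 hy) (hw.laplacian_eq_zero_of_mem_bdry F hb)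
  refine ⟨fun x => F x + ∑ y ∈ hF.toFinset, (green w x y).toReal * laplacian w F y,
    fun x => ?_, fun x hx => ?_, fun π => ?_⟩
  · rw [hw.laplacian_add, hw.laplacian_sum_mul]
    rw [Finset.sum_congr rfl fun y hy => by rw [hw.laplacian_green htrans x (hS y hy)]]
    simp only [ite_mul, neg_mul, one_mul, zero_mul, Finset.sum_ite_eq]
    split_ifs with h
    · ring
    · rw [hF.mem_toFinset] at h
      simpa using h
  · simp only [add_eq_left]
    refine Finset.sum_eq_zero fun y hy => ?_
    simp [hw.green_eq_zero hx (hS y hy)]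
  · simp only [add_sub_cancel_left]
    have hsum : ∑ _y ∈ hF.toFinset, (0 : ℝ) = 0 := Finset.sum_const_zero
    refine (tendsto_finsetSum _ fun y hy => ?_).mono_right (congrArg 𝓝 hsum).le
    have h1 := hvanish π.vert π.toEnd
      (convergesTo_of_eventually_mem_near fun A => π.eventually_mem_near A) y (hS y hy)
    have h2 := (ENNReal.tendsto_toReal ENNReal.zero_ne_top).comp h1
    simpa using h2.mul_const (laplacian w F y)

/-- At a vertex near an end with no edge into `A`, all out-neighbours are near the same end, so
every difference vanishes. Finite in-degrees leave only finitely many exceptions. -/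
theorem finite_laplacian_ne_zero (hw : IsWeight w) (hlf : IsLocallyFinite w) (hconn : IsConn w)
    {A : Finset X} {F : X → ℝ}
    (hF : ∀ (ω : End w) (x y : X), x ∈ near A ω → y ∈ near A ω → F x = F y) :
    {x | laplacian w F x ≠ 0}.Finite := by
  by_cases hne : ∃ o, o ∈ inter w
  · obtain ⟨o, ho⟩ := hne
    refine ((finite_compl_iUnion_near hw hconn ho A).union
      (A.finite_toSet.biUnion fun z _ => (hlf z).2)).subset fun x hx => ?_
    by_contra hcon
    rw [Set.mem_union, not_or, Set.mem_compl_iff, not_not] at hcon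
    obtain ⟨hx1, hx2⟩ := hcon
    obtain ⟨ω, hω⟩ := Set.mem_iUnion.1 hx1
    refine hx ?_
    rw [hw.laplacian_eq]
    refine Finset.sum_eq_zero fun z hz => ?_
    have hzA : z ∉ A := fun h => hx2 (Set.mem_biUnion (Finset.mem_coe.2 h) (hw.mem_out.1 hz))
    have hpos : 0 < w x z := (hw.nonneg x z).lt_of_ne' (hw.mem_out.1 hz)
    rw [hF ω z x (mem_near_of_edge hω hzA hpos) hω, sub_self, mul_zero]
  · push Not at hne
    refine Set.finite_empty.subset fun x hx => hx ?_
    exact hw.laplacian_eq_zero_of_mem_bdry F (not_not.1 (hne x))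

/-- Solutions of the Dirichlet problem up to an error `ε` on `∂X`. -/
theorem exists_approx_solution [Countable X] (hw : IsWeight w) (hlf : IsLocallyFinite w)
    (hconn : IsConn w) [Finite (End w)] (htrans : IsTransient w) (hvanish : GreenVanishes w)
    {f : bdryHat w → ℝ} (hcont : ContinuousAtInfinity f) {ε : ℝ} (hε : 0 < ε) :
    ∃ h : X → ℝ, (∀ x, laplacian w h x = 0) ∧
      (∀ x, ∀ hx : x ∈ bdry w, |h x - f ⟨Sum.inl x, Or.inl ⟨x, hx, rfl⟩⟩| ≤ ε) ∧
      ∀ π : Ray w, Tendsto (fun i => h (π.vert i)) atTop (𝓝 (f (endPt π.toEnd))) := by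
  classical
  obtain ⟨A₀, hA₀⟩ := exists_separating (w := w)
  choose B hB using fun ω : End w => exists_dist_lt_on_near hcont ω hε
  have := Fintype.ofFinite (End w)
  -- `A₀` makes the neighbourhoods of distinct ends disjoint, and `B ω` keeps `f` within `ε` of its
  -- value at `ω`.
  let A : Finset X := A₀ ∪ Finset.univ.biUnion B
  have hA : ∀ (ω ω' : End w) (x : X), x ∈ near A ω → x ∈ near A ω' → ω = ω' :=
    fun ω ω' x h h' => hA₀ ω ω' x (near_anti Finset.subset_union_left ω h)
      (near_anti Finset.subset_union_left ω' h')
  have hAB : ∀ ω, near A ω ⊆ near (B ω) ω := fun ω =>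
    near_anti ((Finset.subset_biUnion_of_mem B (Finset.mem_univ ω)).trans
      Finset.subset_union_right) ω
  let F : X → ℝ := fun x =>
    if h : ∃ ω : End w, x ∈ near A ω then f (endPt h.choose)
    else if hx : x ∈ bdry w then f ⟨Sum.inl x, Or.inl ⟨x, hx, rfl⟩⟩ else 0
  have hF : ∀ (ω : End w) (x : X), x ∈ near A ω → F x = f (endPt ω) := by
    intro ω x hx
    have h : ∃ ω : End w, x ∈ near A ω := ⟨ω, hx⟩
    simp only [F, dif_pos h]
    rw [hA _ _ x h.choose_spec hx]
  obtain ⟨h, hharm, hbd, hlim⟩ := exists_harmonic_sub_tendsto_zero hw htrans hvanish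
    (finite_laplacian_ne_zero hw hlf hconn (A := A) (F := F) fun ω x y hx hy => by
      rw [hF ω x hx, hF ω y hy])
  refine ⟨h, hharm, fun x hx => ?_, fun π => ?_⟩
  · rw [hbd x hx]
    by_cases hn : ∃ ω : End w, x ∈ near A ω
    · obtain ⟨ω, hω⟩ := hn
      rw [hF ω x hω, abs_sub_comm]
      exact (hB ω x hx (hAB ω hω)).le
    · simp only [F, dif_neg hn, dif_pos hx, sub_self, abs_zero]
      exact hε.le
  · have h1 := (hlim π).add_const (f (endPt π.toEnd))
    rw [zero_add] at h1
    refine h1.congr' ?_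
    filter_upwards [π.eventually_mem_near A] with i hi
    rw [hF _ _ hi]
    ring

theorem abs_sub_le_of_harmonic (hw : IsWeight w) (hconn : IsConn w) (htrans : IsTransient w)
    {g h : X → ℝ} (hg : ∀ x, laplacian w g x = 0) (hh : ∀ x, laplacian w h x = 0) {c : ℝ}
    (hbdry : ∀ x ∈ bdry w, |g x - h x| ≤ c)
    (hray : ∀ (π : Ray w) (c' : ℝ), c < c' → ∃ i, |g (π.vert i) - h (π.vert i)| < c') (x : X) :
    |g x - h x| ≤ c := by
  refine abs_sub_le_iff.2 ⟨?_, ?_⟩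
  · refine le_of_isSubharmonic hw hconn htrans (u := fun x => g x - h x)
      (fun x => by rw [hw.laplacian_sub, hg, hh, sub_self])
      (fun x hx => (abs_sub_le_iff.1 (hbdry x hx)).1) (fun π c' hc' => ?_) x
    obtain ⟨i, hi⟩ := hray π c' hc'
    exact ⟨i, (abs_sub_lt_iff.1 hi).1⟩
  · refine le_of_isSubharmonic hw hconn htrans (u := fun x => h x - g x)
      (fun x => by rw [hw.laplacian_sub, hg, hh, sub_self])
      (fun x hx => (abs_sub_le_iff.1 (hbdry x hx)).2) (fun π c' hc' => ?_) x
    obtain ⟨i, hi⟩ := hray π c' hc'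
    exact ⟨i, (abs_sub_lt_iff.1 hi).2⟩

/-- The Dirichlet problem, in terms of limits along rays. -/
theorem exists_solution [Countable X] (hw : IsWeight w) (hlf : IsLocallyFinite w)
    (hconn : IsConn w) [Finite (End w)] (htrans : IsTransient w) (hvanish : GreenVanishes w)
    {f : bdryHat w → ℝ} (hcont : ContinuousAtInfinity f) :
    ∃ h : X → ℝ, (∀ x, laplacian w h x = 0) ∧
      (∀ x, ∀ hx : x ∈ bdry w, h x = f ⟨Sum.inl x, Or.inl ⟨x, hx, rfl⟩⟩) ∧
      ∀ π : Ray w, Tendsto (fun i => h (π.vert i)) atTop (𝓝 (f (endPt π.toEnd))) := by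
  choose h hharm hbd hlim using fun n : ℕ => exists_approx_solution hw hlf hconn htrans hvanish
    hcont (ε := 1 / ((n : ℝ) + 1)) Nat.one_div_pos_of_nat
  have hε : Tendsto (fun n : ℕ => 1 / ((n : ℝ) + 1)) atTop (𝓝 0) :=
    tendsto_one_div_add_atTop_nhds_zero_nat
  have hclose : ∀ n m x, |h n x - h m x| ≤ 1 / ((n : ℝ) + 1) + 1 / ((m : ℝ) + 1) := by
    intro n m
    -- The two errors add up on `∂X`; along a ray both functions have the same limit, so their
    -- difference tends to `0`.
    refine abs_sub_le_of_harmonic hw hconn htrans (hharm n) (hharm m) (fun x hx => ?_)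
      fun π c' hc' => ?_
    · have h1 := hbd n x hx
      have h2 := hbd m x hx
      rw [abs_sub_comm] at h2
      exact (abs_sub_le _ _ _).trans (add_le_add h1 h2)
    · have h1 := ((hlim n π).sub (hlim m π)).abs
      rw [sub_self, abs_zero] at h1
      have hc0 : 0 < c' := lt_trans (add_pos Nat.one_div_pos_of_nat Nat.one_div_pos_of_nat) hc'
      exact (h1.eventually_lt_const hc0).exists
  have hcauchy : ∀ x, CauchySeq fun n => h n x := by
    intro x
    refine cauchySeq_of_le_tendsto_0 (fun n : ℕ => 1 / ((n : ℝ) + 1) + 1 / ((n : ℝ) + 1))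
      (fun n m N hn hm => ?_) (by simpa using hε.add hε)
    rw [Real.dist_eq]
    exact (hclose n m x).trans
      (add_le_add (Nat.one_div_le_one_div hn) (Nat.one_div_le_one_div hm))
  choose g hg using fun x => cauchySeq_tendsto_of_complete (hcauchy x)
  have hgclose : ∀ n x, |h n x - g x| ≤ 1 / ((n : ℝ) + 1) := by
    intro n x
    have h1 := hε.const_add (1 / ((n : ℝ) + 1))
    rw [add_zero] at h1
    exact le_of_tendsto_of_tendsto' ((hg x).const_sub (h n x)).abs h1 fun m => hclose n m x
  refine ⟨g, fun x => ?_, fun x hx => ?_, fun π => ?_⟩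
  -- The Laplacian is a finite sum, so pointwise convergence preserves harmonicity; limits along
  -- rays need the uniform bound `hgclose`.
  · have h1 : Tendsto (fun n => laplacian w (h n) x) atTop (𝓝 (laplacian w g x)) := by
      simp only [hw.laplacian_eq]
      exact tendsto_finsetSum _ fun z _ => ((hg z).sub (hg x)).const_mul _
    simp only [hharm] at h1
    exact tendsto_nhds_unique h1 tendsto_const_nhds
  · refine tendsto_nhds_unique (hg x) (tendsto_iff_dist_tendsto_zero.2 ?_)
    exact squeeze_zero (fun _ => dist_nonneg) (fun n => by rw [Real.dist_eq]; exact hbd n x hx) hε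
  · rw [Metric.tendsto_nhds]
    intro δ hδ
    obtain ⟨n, hn⟩ := (hε.eventually_lt_const (half_pos hδ)).exists
    filter_upwards [Metric.tendsto_nhds.1 (hlim n π) (δ / 2) (half_pos hδ)] with i hi
    have h1 := hgclose n (π.vert i)
    rw [abs_sub_comm, ← Real.dist_eq] at h1
    linarith [dist_triangle (g (π.vert i)) (h n (π.vert i)) (f (endPt π.toEnd))]

/-! ### Harmonic functions on `X̂` and the Dirichlet problem -/

/-- The upper limit conditions for `h` and `-h` bound `h` along a ray from both sides. Taken in
`EReal`, they need no prior boundedness. -/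
theorem mem_harmonicHat_iff (hw : IsWeight w) {h : Hat w → ℝ} :
    h ∈ harmonicHat w ↔ (∀ x, laplacian w (fun z => h (Sum.inl z)) x = 0) ∧
      ∀ π : Ray w, Tendsto (fun i => h (Sum.inl (π.vert i))) atTop
        (𝓝 (h (Sum.inr π.toEnd))) := by
  have hneg : ∀ x, laplacian w (fun z => (-h) (Sum.inl z)) x =
      -laplacian w (fun z => h (Sum.inl z)) x := fun x => hw.laplacian_neg _ x
  constructor
  · rintro ⟨⟨h1, h2⟩, h3, h4⟩
    refine ⟨fun x => le_antisymm ?_ (h1 x), fun π => ?_⟩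
    · have := h3 x
      rw [hneg] at this
      linarith
    · have h5 := h2 _ π rfl
      have h6 := h4 _ π rfl
      rw [tendsto_order]
      refine ⟨fun a ha => ?_, fun a ha => ?_⟩
      · have : (((-h) (Sum.inr π.toEnd) : ℝ) : EReal) < ((-a : ℝ) : EReal) :=
          EReal.coe_lt_coe_iff.2 (neg_lt_neg ha)
        filter_upwards [eventually_lt_of_limsup_lt (h6.trans_lt this)] with i hi
        exact neg_lt_neg_iff.1 (EReal.coe_lt_coe_iff.1 hi)
      · filter_upwards [eventually_lt_of_limsup_lt
          (h5.trans_lt (EReal.coe_lt_coe_iff.2 ha))] with i hi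
        exact EReal.coe_lt_coe_iff.1 hi
  · rintro ⟨h1, h2⟩
    refine ⟨⟨fun x => (h1 x).ge, ?_⟩, fun x => by rw [hneg, h1, neg_zero], ?_⟩
    · rintro _ π rfl
      exact ((continuous_coe_real_ereal.tendsto _).comp (h2 π)).limsup_eq.le
    · rintro _ π rfl
      exact ((continuous_coe_real_ereal.tendsto _).comp (h2 π).neg).limsup_eq.le

end DirichletEnds

theorem theoremT {X : Type*} [Countable X] (w : X → X → ℝ)
    (hw : DirichletEnds.IsWeight w) (hlf : DirichletEnds.IsLocallyFinite w)
    (hconn : DirichletEnds.IsConn w) (hqr : DirichletEnds.IsQuasiReversible w)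
    (hends : Finite (DirichletEnds.End w))
    (htrans : DirichletEnds.IsTransient w) (hvanish : DirichletEnds.GreenVanishes w)
    (f : DirichletEnds.bdryHat w → ℝ)
    (hbdd : ∃ M : ℝ, ∀ p, |f p| ≤ M) (hcont : DirichletEnds.ContinuousAtInfinity f) :
    ∃! h : DirichletEnds.Hat w → ℝ,
      h ∈ DirichletEnds.harmonicHat w ∧ ∀ p : DirichletEnds.bdryHat w, h p = f p := by
  classical
  obtain ⟨g, hg, hgb, hgl⟩ :=
    DirichletEnds.exists_solution hw hlf hconn htrans hvanish hcont
  refine ⟨Sum.elim g fun ω => f (DirichletEnds.endPt ω), ⟨?_, ?_⟩, ?_⟩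
  · exact (DirichletEnds.mem_harmonicHat_iff hw).2 ⟨hg, hgl⟩
  · rintro ⟨_, ⟨x, hx, rfl⟩ | ⟨ω, rfl⟩⟩
    · exact hgb x hx
    · rfl
  · rintro k ⟨hk, hkf⟩
    obtain ⟨hk1, hk2⟩ := (DirichletEnds.mem_harmonicHat_iff hw).1 hk
    funext p
    rcases p with x | ω
    -- Comparison with `c = 0`: both functions agree on `∂X` and share their limits along rays.
    · refine sub_eq_zero.1 (abs_nonpos_iff.1 (DirichletEnds.abs_sub_le_of_harmonic hw hconn htrans
        (g := fun x => k (Sum.inl x)) hk1 hg (fun y hy => ?_) (fun π c' hc' => ?_) x))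
      · rw [hgb y hy, ← hkf]
        simp
      · have h1 := ((hk2 π).sub (hgl π)).abs
        rw [← hkf, DirichletEnds.endPt, sub_self, abs_zero] at h1
        exact (h1.eventually_lt_const hc').exists
    · exact hkf (DirichletEnds.endPt ω)
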